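/- Let $\mathbb S$ be a measurable space whose points are separated by countably many measurable sets (for instance a standard Borel space), let $G_0$ be a non-atomic probability measure on $\mathbb S$, let $\theta>0$ and $J\ge 1$. Let $P\sim\mathrm{DP}(\theta,G_0)$ be a Dirichlet process, i.e. a random probability measure on $\mathbb S$ such that $(P(A_1),\dots,P(A_k))$ has the Dirichlet distribution with parameters $(\theta G_0(A_1),\dots,\theta G_0(A_k))$ for every finite measurable partition $(A_1,\dots,A_k)$ of $\mathbb S$. For a measurable hash function $h:\mathbb S\to\{1,\dots,J\}$ write $\mathbb S_j=\{s: h(s)=j\}$. For a probability measure $p$ on $\mathbb S$ and $X_1,\dots,X_{n+1}$ i.i.d. from $p$ let $C_i=\#\{m\le n: h(X_m)=i\}$ be the sketch of the sample $(X_1,\dots,X_n)$, let $f_{X_{n+1}}=\#\{m\le n: X_m=X_{n+1}\}$, and for $\mathbf c=(c_1,\dots,c_J)\in\mathbb N_0^J$ with $\sum_i c_i=n$ put $$\pi_j(r;p)=\Pr[f_{X_{n+1}}=r\mid \mathbf C_J=\mathbf c,\ h(X_{n+1})=j],\qquad \varepsilon_f(p)=\mathbb E[f_{X_{n+1}}\mid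 \mathbf C_J=\mathbf c,\ h(X_{n+1})=j].$$ Let $h$ be a random hash function, drawn independently of $P$ from a strongly universal family, that is, $\Pr[h(x)=i,\,h(y)=j]=J^{-2}$ for all $x\neq y$ in $\mathbb S$ and all $i,j$; the family is also independent of draws from $G_0$ in the sense that, for each $j$, the probability that two independent draws from $G_0$ are both hashed to $j$ may be computed by averaging over $h$ and over the draws in either order. Then almost every $h$ satisfies $G_0(\mathbb S_j)=1/J$ for all $j$. For every measurable $h$ with this property (hence for almost every $h$), and for every $j$: 1. Let $P_j=P(\,\cdot\cap\mathbb S_j)/P(\mathbb S_j)$, and let $V_j=P_j(\{X\})$ be the mass that $P_j$ gives to a symbol $X$ which is drawn from $P_j$ given $P$. Then $V_j\sim\mathrm{Beta}(1,\theta/J)$. 2. For all $n$, all $\mathbf c$ with $\sum_i c_i=n$ and all $0\le r\le c_j$, the smoothed probability $\pi_j(r):=\mathbb E_{P\sim \mathrm{DP}(\theta,G_0)}[\pi_j(r;P)]$ is the mixture of Binomial probabilities with mixing variable $V_j$, and is the Beta-Binomial probability with parameters $(c_j,1,\theta/J)$: $$\pi_j(r)=\mathbb E\left[\binom{c_j}{r}V_j^r(1-V_j)^{c_j-r}\right]=\binom{c_j}{r}\frac{\theta}{J}\,\frac{\Gamma(r+1)\,\Gamma(\theta/J+c_j-r)}{\Gamma(\theta/J+c_j+1)}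 .$$ 3. For all such $n$ and $\mathbf c$, the smoothed frequency estimator is $$\mathbb E_{P\sim\mathrm{DP}(\theta,G_0)}[\varepsilon_f(P)]=c_j\,\frac{J}{\theta+J}.$$ -/

import Mathlib

open MeasureTheory ProbabilityTheory
open scoped ENNReal

namespace SmoothedSketch

/-! ### Hash functions -/

/-- The set of symbols that the hash function `g` sends to bucket `j`. -/
def bucket {S : Type*} {J : ℕ} (g : S → Fin J) (j : Fin J) : Set S := g ⁻¹' {j}

/-- Strong universality (pairwise independence) of the random hash function `h u`, `u ∼ Q`:
two distinct symbols are hashed to any two buckets with probability `J⁻²`. -/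
structure IsStronglyUniversal {U S : Type*} [MeasurableSpace U] {J : ℕ}
    (Q : Measure U) (h : U → S → Fin J) : Prop where
  measurable_eval : ∀ x, Measurable fun u => h u x
  pairwise : ∀ x y, x ≠ y → ∀ i j,
    Q {u | h u x = i ∧ h u y = j} = ((J : ℝ≥0∞) ^ 2)⁻¹

/-- The random hash function `h u`, `u ∼ Q`, is drawn independently of symbols drawn from `G₀`:
the probability that two independent draws from `G₀` are both hashed to `j` is the same whether
one first averages over the draws or over the hash function.  (Joint measurability of
`(u, x) ↦ h u x` would give this by Fubini, but a strongly universal family with `J ≥ 2` cannot be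
jointly measurable when `G₀` has no atoms, so the exchange of the two averages is all that can be
asked for.) -/
def IsIndepOfDraws {U S : Type*} [MeasurableSpace U] [MeasurableSpace S] {J : ℕ}
    (Q : Measure U) (h : U → S → Fin J) (G₀ : Measure S) : Prop :=
  ∀ j, AEMeasurable (fun u => (G₀.prod G₀) {p | h u p.1 = j ∧ h u p.2 = j}) Q ∧
    ∫⁻ u, (G₀.prod G₀) {p | h u p.1 = j ∧ h u p.2 = j} ∂Q
      = ∫⁻ p, Q {u | h u p.1 = j ∧ h u p.2 = j} ∂(G₀.prod G₀)

/-! ### The Dirichlet process -/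

/-- The Gamma distribution with shape `a ≥ 0` and rate `1`; it is the unit mass at `0` for
`a = 0`. -/
noncomputable def gammaLaw (a : ℝ) : Measure ℝ :=
  if a = 0 then Measure.dirac 0 else gammaMeasure a 1

/-- The Dirichlet distribution with parameters `α i ≥ 0`, not all zero: the law of independent
Gamma variables with shapes `α i`, divided by their sum. -/
noncomputable def dirichletLaw {k : ℕ} (α : Fin k → ℝ) : Measure (Fin k → ℝ) :=
  (Measure.pi fun i => gammaLaw (α i)).map fun y i => y i / ∑ l, y l

/-- `P ∼ DP(θ, G₀)`: `P` is a random probability measure whose values on every finite measurable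
partition `A` have the Dirichlet distribution with parameters `θ G₀(A i)`. -/
structure IsDirichletProcess {Ω S : Type*} [MeasurableSpace Ω] [MeasurableSpace S]
    (μ : Measure Ω) (P : Ω → Measure S) (θ : ℝ) (G₀ : Measure S) : Prop where
  measurable : Measurable P
  isProbabilityMeasure : ∀ ω, IsProbabilityMeasure (P ω)
  map_partition : ∀ (k : ℕ) (A : Fin k → Set S), (∀ i, MeasurableSet (A i)) →
    Pairwise (fun i i' => Disjoint (A i) (A i')) → (⋃ i, A i) = Set.univ →
    μ.map (fun ω i => (P ω).real (A i)) = dirichletLaw fun i => θ * G₀.real (A i)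

/-! ### The sampling model for a given hash function -/

/-- The sketch of the sample `x`: the number of sample points in each bucket. -/
def sketch {S : Type*} {J n : ℕ} (g : S → Fin J) (x : Fin n → S) (j : Fin J) : ℕ :=
  (Finset.univ.filter fun i => g (x i) = j).card

open Classical in
/-- The empirical frequency of the symbol `s` in the sample `x`. -/
noncomputable def freq {S : Type*} {n : ℕ} (x : Fin n → S) (s : S) : ℕ :=
  (Finset.univ.filter fun i => x i = s).card

/-- The conditional law of `(X₁, …, Xₙ, Xₙ₊₁)`, i.i.d. from `p`, given that `(X₁, …, Xₙ)` has
sketch `c` and that `Xₙ₊₁` is hashed to bucket `j`. -/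
noncomputable def condSample {S : Type*} [MeasurableSpace S] {J : ℕ} (g : S → Fin J) (n : ℕ)
    (c : Fin J → ℕ) (j : Fin J) (p : Measure S) : Measure (Fin (n + 1) → S) :=
  ProbabilityTheory.cond (Measure.pi fun _ : Fin (n + 1) => p)
    {x | sketch g (Fin.init x) = c ∧ g (x (Fin.last n)) = j}

/-- `π_j(r; p)`: the conditional probability that `Xₙ₊₁` has frequency `r` in the sample. -/
noncomputable def freqProb {S : Type*} [MeasurableSpace S] {J : ℕ} (g : S → Fin J) (n : ℕ)
    (c : Fin J → ℕ) (j : Fin J) (r : ℕ) (p : Measure S) : ℝ :=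
  (condSample g n c j p).real {x | freq (Fin.init x) (x (Fin.last n)) = r}

/-- `ε_f(p)`: the conditional expectation of the frequency of `Xₙ₊₁` in the sample. -/
noncomputable def freqMean {S : Type*} [MeasurableSpace S] {J : ℕ} (g : S → Fin J) (n : ℕ)
    (c : Fin J → ℕ) (j : Fin J) (p : Measure S) : ℝ :=
  ∫ x, (freq (Fin.init x) (x (Fin.last n)) : ℝ) ∂(condSample g n c j p)

/-- `p_j`: the law `p`, restricted to bucket `j` and renormalized. -/
noncomputable def bucketLaw {S : Type*} [MeasurableSpace S] {J : ℕ} (g : S → Fin J) (j : Fin J)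
    (p : Measure S) : Measure S :=
  ProbabilityTheory.cond p (bucket g j)

/-- The law of the mixing variable `V_j`, the mass `P_j {X}` that the random measure `P_j` gives
to a symbol `X` drawn from `P_j`. -/
noncomputable def mixingLaw {Ω S : Type*} [MeasurableSpace Ω] [MeasurableSpace S] {J : ℕ}
    (μ : Measure Ω) (P : Ω → Measure S) (g : S → Fin J) (j : Fin J) : Measure ℝ :=
  μ.bind fun ω => (bucketLaw g j (P ω)).map fun s => (bucketLaw g j (P ω)).real {s}

/-- The probability mass function of the Beta-Binomial distribution with parameters
`(m, a, b)`, at `r ≤ m`. -/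
noncomputable def betaBinomial (m : ℕ) (a b : ℝ) (r : ℕ) : ℝ :=
  (m.choose r : ℝ) * beta (a + r) (b + m - r) / beta a b

end SmoothedSketch

/-! For `A ⊆ B` the ratio `P A / P B` is `Y / (Y + Z)` with independent Gamma variables `Y` and `Z`,
so its moments are ratios of rising factorials. Summed over finer and finer partitions of bucket
`j` they converge to the moments of the mass `V_j` of a symbol drawn from `P_j`; since `G₀` has no
atoms, the limits are `k! / (b + 1)(b + 2)⋯(b + k)` with `b = θ G₀(𝕊_j)`, which are the moments of
`Beta(1, b)`, and a law on `[0, 1]` is determined by its moments.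

Given the buckets of all symbols of the sample, these are independent, and a symbol `s` of bucket
`j` can only occur at the `c_j` positions of bucket `j`, each time with probability `P_j {s}`. So
its frequency is Binomial with parameters `c_j` and `P_j {s}`, however the buckets are arranged.

Finally `𝔼[G₀(𝕊_j)²] = J⁻²` because a strongly universal family hashes two independent draws, which
are almost surely distinct, to `j` with this probability; as `∑ G₀(𝕊_j) = 1`, the masses
`G₀(𝕊_j)` have no room to vary.
-/

namespace SmoothedSketch

open Filter Topology

/-! ### Moment determinacy -/

theorem hasSum_charFun_of_ae_abs_le {ν : Measure ℝ} [IsFiniteMeasure ν] {M : ℝ}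
    (hν : ∀ᵐ x ∂ν, |x| ≤ M) (t : ℝ) :
    HasSum (fun k : ℕ => (t * Complex.I) ^ k / k.factorial * ((∫ x, x ^ k ∂ν : ℝ) : ℂ))
      (charFun ν t) := by
  have hterm (k : ℕ) : ∫ x : ℝ, (t * x * Complex.I) ^ k / k.factorial ∂ν
      = (t * Complex.I) ^ k / k.factorial * ((∫ x, x ^ k ∂ν : ℝ) : ℂ) := by
    rw [← integral_complex_ofReal, ← integral_const_mul]
    congr with x
    push_cast
    ring
  simp only [← hterm, charFun_apply_real]
  refine hasSum_integral_of_dominated_convergence (fun k _ => (|t| * M) ^ k / k.factorial)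
    (fun k => by fun_prop) (fun k => ?_) (ae_of_all _ fun _ => Real.summable_pow_div_factorial _)
    (integrable_const _) (ae_of_all _ fun x => ?_)
  · filter_upwards [hν] with x hx
    simp only [norm_div, norm_pow, norm_mul, Complex.norm_real, Complex.norm_I, mul_one,
      Real.norm_eq_abs, Complex.norm_natCast]
    gcongr
  · rw [Complex.exp_eq_exp_ℂ]
    exact NormedSpace.expSeries_div_hasSum_exp _

theorem ext_of_integral_pow_eq {ν₁ ν₂ : Measure ℝ} [IsFiniteMeasure ν₁] [IsFiniteMeasure ν₂]
    {M : ℝ} (h₁ : ∀ᵐ x ∂ν₁, |x| ≤ M) (h₂ : ∀ᵐ x ∂ν₂, |x| ≤ M)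
    (h : ∀ k : ℕ, ∫ x, x ^ k ∂ν₁ = ∫ x, x ^ k ∂ν₂) : ν₁ = ν₂ := by
  refine Measure.ext_of_charFun (funext fun t => ?_)
  have h₁' := hasSum_charFun_of_ae_abs_le h₁ t
  simp only [h] at h₁'
  exact h₁'.unique (hasSum_charFun_of_ae_abs_le h₂ t)

-- A Laplace transform at the integers is the moment sequence of the bounded variable `exp (-x)`.
theorem ext_of_integral_exp_neg_nat_mul_eq {ν₁ ν₂ : Measure ℝ} [IsFiniteMeasure ν₁]
    [IsFiniteMeasure ν₂] (h₁ : ∀ᵐ x ∂ν₁, 0 ≤ x) (h₂ : ∀ᵐ x ∂ν₂, 0 ≤ x)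
    (h : ∀ k : ℕ, ∫ x, Real.exp (-(k * x)) ∂ν₁ = ∫ x, Real.exp (-(k * x)) ∂ν₂) : ν₁ = ν₂ := by
  have hE : MeasurableEmbedding fun x : ℝ => Real.exp (-x) :=
    Continuous.measurableEmbedding (by fun_prop) (Real.exp_injective.comp neg_injective)
  have hbound {ν : Measure ℝ} (hν : ∀ᵐ x ∂ν, 0 ≤ x) :
      ∀ᵐ v ∂ν.map fun x => Real.exp (-x), |v| ≤ 1 := by
    rw [hE.ae_map_iff]
    filter_upwards [hν] with x hx
    simpa using hx
  refine hE.map_injective (ext_of_integral_pow_eq (hbound h₁) (hbound h₂) fun k => ?_)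
  simpa only [hE.integral_map, ← Real.exp_nat_mul, mul_neg] using h k

/-! ### The Gamma laws -/

theorem ascPochhammer_eval_nonneg {a : ℝ} (ha : 0 ≤ a) (k : ℕ) :
    0 ≤ (ascPochhammer ℝ k).eval a := by
  rcases ha.eq_or_lt with rfl | ha
  · rw [ascPochhammer_eval_zero]
    positivity
  · exact (ascPochhammer_pos k a ha).le

theorem ascPochhammer_eval_mul_Gamma {a : ℝ} (ha : 0 < a) (k : ℕ) :
    (ascPochhammer ℝ k).eval a * Real.Gamma a = Real.Gamma (a + k) := by
  induction k with
  | zero => simp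
  | succ k ih =>
    have : a + k ≠ 0 := by positivity
    rw [ascPochhammer_succ_eval, Nat.cast_succ, ← add_assoc, Real.Gamma_add_one this, ← ih]
    ring

@[simp] theorem gammaLaw_zero : gammaLaw 0 = Measure.dirac 0 := if_pos rfl

theorem gammaLaw_eq_withDensity {a : ℝ} (ha : 0 < a) :
    gammaLaw a = (volume.restrict (Set.Ioi 0)).withDensity
      fun x => ENNReal.ofReal (x ^ (a - 1) * Real.exp (-x) / Real.Gamma a) := by
  rw [gammaLaw, if_neg ha.ne', gammaMeasure, Measure.restrict_congr_set Ioi_ae_eq_Ici,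
    ← withDensity_indicator measurableSet_Ici]
  congr with x
  by_cases hx : 0 ≤ x
  · rw [gammaPDF_of_nonneg hx, Set.indicator_of_mem (Set.mem_Ici.2 hx), Real.one_rpow]
    ring_nf
  · simp [gammaPDF_of_neg (not_le.1 hx), hx]

theorem isProbabilityMeasure_gammaLaw {a : ℝ} (ha : 0 ≤ a) :
    IsProbabilityMeasure (gammaLaw a) := by
  rcases ha.eq_or_lt with rfl | ha
  · rw [gammaLaw_zero]
    infer_instance
  · rw [gammaLaw, if_neg ha.ne']
    exact isProbabilityMeasure_gammaMeasure ha one_pos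

theorem ae_pos_gammaLaw {a : ℝ} (ha : 0 < a) : ∀ᵐ x ∂gammaLaw a, 0 < x := by
  rw [gammaLaw_eq_withDensity ha]
  exact (withDensity_absolutelyContinuous _ _).ae_le (ae_restrict_mem measurableSet_Ioi)

theorem ae_nonneg_gammaLaw {a : ℝ} (ha : 0 ≤ a) : ∀ᵐ x ∂gammaLaw a, 0 ≤ x := by
  rcases ha.eq_or_lt with rfl | ha
  · rw [gammaLaw_zero, ae_dirac_iff measurableSet_Ici]
  · exact (ae_pos_gammaLaw ha).mono fun _ => le_of_lt

theorem integral_exp_neg_mul_gammaLaw {a t : ℝ} (ha : 0 ≤ a) (ht : 0 ≤ t) :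
    ∫ x, Real.exp (-(t * x)) ∂gammaLaw a = (1 + t) ^ (-a) := by
  rcases ha.eq_or_lt with rfl | ha
  · simp
  have := Real.Gamma_pos_of_pos ha
  rw [gammaLaw_eq_withDensity ha, integral_withDensity_eq_integral_toReal_smul (by fun_prop)
    (ae_of_all _ fun _ => ENNReal.ofReal_lt_top)]
  calc _ = ∫ x in Set.Ioi 0,
        (Real.Gamma a)⁻¹ * (x ^ (a - 1) * Real.exp (-((1 + t) * x))) := by
        refine setIntegral_congr_fun measurableSet_Ioi fun x (hx : 0 < x) => ?_
        simp only [smul_eq_mul]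
        rw [ENNReal.toReal_ofReal (by positivity), add_mul, one_mul, neg_add, Real.exp_add]
        ring
    _ = (1 + t) ^ (-a) := by
        rw [integral_const_mul, Real.integral_rpow_mul_exp_neg_mul_Ioi ha (by positivity),
          Real.rpow_neg (by positivity), one_div, Real.inv_rpow (by positivity)]
        field_simp

theorem gammaLaw_withDensity_pow {a : ℝ} (ha : 0 ≤ a) (k : ℕ) :
    (gammaLaw a).withDensity (fun x => ENNReal.ofReal (x ^ k))
      = ENNReal.ofReal ((ascPochhammer ℝ k).eval a) • gammaLaw (a + k) := by
  rcases ha.eq_or_lt with rfl | ha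
  · rcases k with _ | k <;> simp [dirac_withDensity]
  · have hk : 0 < a + k := by positivity
    have := Real.Gamma_pos_of_pos ha
    rw [gammaLaw_eq_withDensity ha, gammaLaw_eq_withDensity hk,
      ← withDensity_mul _ (by fun_prop) (by fun_prop), ← withDensity_smul _ (by fun_prop)]
    refine withDensity_congr_ae ?_
    filter_upwards [ae_restrict_mem measurableSet_Ioi] with x (hx : 0 < x)
    have hasc := ascPochhammer_pos k a ha
    simp only [Pi.mul_apply, Pi.smul_apply, smul_eq_mul]
    rw [← ENNReal.ofReal_mul (by positivity), ← ENNReal.ofReal_mul hasc.le,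
      ← ascPochhammer_eval_mul_Gamma ha, add_sub_right_comm, Real.rpow_add_natCast hx.ne']
    congr 1
    field_simp

theorem gammaLaw_conv_gammaLaw {a c : ℝ} (ha : 0 ≤ a) (hc : 0 ≤ c) :
    gammaLaw a ∗ gammaLaw c = gammaLaw (a + c) := by
  have := isProbabilityMeasure_gammaLaw ha
  have := isProbabilityMeasure_gammaLaw hc
  have := isProbabilityMeasure_gammaLaw (add_nonneg ha hc)
  refine ext_of_integral_exp_neg_nat_mul_eq ?_ (ae_nonneg_gammaLaw (add_nonneg ha hc)) fun k => ?_
  · rw [Measure.conv, ae_map_iff (by fun_prop) measurableSet_Ici]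
    filter_upwards [Measure.quasiMeasurePreserving_fst.ae (ae_nonneg_gammaLaw ha),
      Measure.quasiMeasurePreserving_snd.ae (ae_nonneg_gammaLaw hc)] with z h₁ h₂
    exact add_nonneg h₁ h₂
  · rw [Measure.conv, integral_map (by fun_prop) (by fun_prop)]
    simp only [mul_add, neg_add (k * _ : ℝ), Real.exp_add]
    rw [integral_prod_mul (fun x => Real.exp (-(k * x))) fun y => Real.exp (-(k * y)),
      integral_exp_neg_mul_gammaLaw ha k.cast_nonneg,
      integral_exp_neg_mul_gammaLaw hc k.cast_nonneg,
      integral_exp_neg_mul_gammaLaw (add_nonneg ha hc) k.cast_nonneg,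
      ← Real.rpow_add (by positivity), neg_add]

theorem integral_withDensity_ofReal {α : Type*} [MeasurableSpace α] {ν : Measure α} {w : α → ℝ}
    (hw : Measurable w) (hw0 : 0 ≤ᵐ[ν] w) (f : α → ℝ) :
    ∫ x, f x ∂ν.withDensity (fun x => ENNReal.ofReal (w x)) = ∫ x, w x * f x ∂ν := by
  rw [integral_withDensity_eq_integral_toReal_smul (by fun_prop)
    (ae_of_all _ fun _ => ENNReal.ofReal_lt_top)]
  refine integral_congr_ae ?_
  filter_upwards [hw0] with x hx
  rw [ENNReal.toReal_ofReal hx, smul_eq_mul]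

theorem integral_inv_pow_gammaLaw {a : ℝ} (ha : 0 < a) (k : ℕ) :
    ∫ s, (s ^ k)⁻¹ ∂gammaLaw (a + k) = ((ascPochhammer ℝ k).eval a)⁻¹ := by
  have := isProbabilityMeasure_gammaLaw ha.le
  refine eq_inv_of_mul_eq_one_right ?_
  calc (ascPochhammer ℝ k).eval a * ∫ s, (s ^ k)⁻¹ ∂gammaLaw (a + k)
    _ = ∫ s, (s ^ k)⁻¹ ∂(gammaLaw a).withDensity fun s => ENNReal.ofReal (s ^ k) := by
        rw [gammaLaw_withDensity_pow ha.le, integral_smul_measure,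
          ENNReal.toReal_ofReal (ascPochhammer_pos k a ha).le, smul_eq_mul]
    _ = ∫ _, 1 ∂gammaLaw a := by
        rw [integral_withDensity_ofReal (by fun_prop)
          ((ae_nonneg_gammaLaw ha.le).mono fun s hs => pow_nonneg hs k)]
        refine integral_congr_ae ?_
        filter_upwards [ae_pos_gammaLaw ha] with s hs
        exact mul_inv_cancel₀ (pow_pos hs k).ne'
    _ = 1 := by simp

-- Weighting by `x ^ k` turns `gammaLaw a` into a multiple of `gammaLaw (a + k)`, and then only
-- the sum of the two variables is left.
theorem integral_div_add_pow_gammaLaw_prod {a c : ℝ} (ha : 0 ≤ a) (hc : 0 ≤ c) (hac : 0 < a + c)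
    (k : ℕ) :
    ∫ z, (z.1 / (z.1 + z.2)) ^ k ∂(gammaLaw a).prod (gammaLaw c)
      = (ascPochhammer ℝ k).eval a / (ascPochhammer ℝ k).eval (a + c) := by
  have := isProbabilityMeasure_gammaLaw ha
  have := isProbabilityMeasure_gammaLaw hc
  have hak : 0 ≤ a + k := by positivity
  have := isProbabilityMeasure_gammaLaw hak
  have hasc : 0 ≤ (ascPochhammer ℝ k).eval a := ascPochhammer_eval_nonneg ha k
  calc _ = ∫ z, z.1 ^ k * ((z.1 + z.2) ^ k)⁻¹ ∂(gammaLaw a).prod (gammaLaw c) := by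
        simp only [div_eq_mul_inv, mul_pow, inv_pow]
    _ = ∫ z, ((z.1 + z.2) ^ k)⁻¹
          ∂((gammaLaw a).withDensity fun x => ENNReal.ofReal (x ^ k)).prod (gammaLaw c) := by
        rw [prod_withDensity_left (by fun_prop), integral_withDensity_ofReal (by fun_prop)]
        filter_upwards [Measure.quasiMeasurePreserving_fst.ae (ae_nonneg_gammaLaw ha)] with z hz
        exact pow_nonneg hz k
    _ = (ascPochhammer ℝ k).eval a * ∫ s, (s ^ k)⁻¹ ∂(gammaLaw (a + k) ∗ gammaLaw c) := by
        rw [gammaLaw_withDensity_pow ha, Measure.prod_smul_left, integral_smul_measure,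
          ENNReal.toReal_ofReal hasc, smul_eq_mul, Measure.conv,
          integral_map (by fun_prop) (by fun_prop)]
    _ = _ := by
        rw [gammaLaw_conv_gammaLaw hak hc, add_right_comm, integral_inv_pow_gammaLaw hac,
          div_eq_mul_inv]

/-! ### The Beta laws -/

theorem ae_mem_Icc_betaMeasure (a b : ℝ) : ∀ᵐ x ∂betaMeasure a b, x ∈ Set.Icc (0 : ℝ) 1 := by
  have hm : Measurable (betaPDF a b) := (measurable_betaPDFReal a b).ennreal_ofReal
  rw [betaMeasure, ae_withDensity_iff hm]
  refine ae_of_all _ fun x hx => ⟨?_, ?_⟩ <;> by_contra! hlt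
  · exact hx (betaPDF_eq_zero_of_nonpos hlt.le)
  · exact hx (betaPDF_eq_zero_of_one_le hlt.le)

theorem integral_betaMeasure {a b : ℝ} (ha : 0 < a) (hb : 0 < b) (f : ℝ → ℝ) :
    ∫ x, f x ∂betaMeasure a b = ∫ x, betaPDFReal a b x * f x := by
  refine integral_withDensity_ofReal (measurable_betaPDFReal a b) (ae_of_all _ fun x => ?_) f
  by_cases hx : 0 < x ∧ x < 1
  · exact (betaPDFReal_pos hx.1 hx.2 ha hb).le
  · simp [betaPDFReal, hx]

theorem betaPDFReal_mul_pow_mul_pow {a b : ℝ} (ha : 0 < a) (hb : 0 < b) (r q : ℕ) (x : ℝ) :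
    betaPDFReal a b x * (x ^ r * (1 - x) ^ q)
      = beta (a + r) (b + q) / beta a b * betaPDFReal (a + r) (b + q) x := by
  by_cases hx : 0 < x ∧ x < 1
  · have hx1 : 0 < 1 - x := sub_pos.2 hx.2
    have hab := (beta_pos ha hb).ne'
    have harq := (beta_pos (add_pos_of_pos_of_nonneg ha r.cast_nonneg)
      (add_pos_of_pos_of_nonneg hb q.cast_nonneg)).ne'
    simp only [betaPDFReal, hx, and_self, if_true, add_sub_right_comm _ (_ : ℝ) (1 : ℝ),
      Real.rpow_add hx.1, Real.rpow_add hx1, Real.rpow_natCast]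
    field_simp
  · simp [betaPDFReal, hx]

theorem integral_pow_mul_pow_betaMeasure {a b : ℝ} (ha : 0 < a) (hb : 0 < b) (r q : ℕ) :
    ∫ x, x ^ r * (1 - x) ^ q ∂betaMeasure a b = beta (a + r) (b + q) / beta a b := by
  have har : 0 < a + r := by positivity
  have hbq : 0 < b + q := by positivity
  have := isProbabilityMeasureBeta har hbq
  have hone : ∫ x, betaPDFReal (a + r) (b + q) x = 1 := by
    simpa using (integral_betaMeasure har hbq fun _ => 1).symm
  simp only [integral_betaMeasure ha hb, betaPDFReal_mul_pow_mul_pow ha hb, integral_const_mul,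
    hone, mul_one]

theorem integral_pow_betaMeasure_one {b : ℝ} (hb : 0 < b) (k : ℕ) :
    ∫ x, x ^ k ∂betaMeasure 1 b = k.factorial / (ascPochhammer ℝ k).eval (b + 1) := by
  have hb1 : 0 < b + 1 := by positivity
  have hmom := integral_pow_mul_pow_betaMeasure one_pos hb k 0
  simp only [pow_zero, mul_one, Nat.cast_zero, add_zero] at hmom
  have hΓ := (Real.Gamma_pos_of_pos hb).ne'
  have hΓ1 := (Real.Gamma_pos_of_pos hb1).ne'
  rw [hmom, beta, beta, add_right_comm, add_comm 1 b, ← ascPochhammer_eval_mul_Gamma one_pos,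
    ← ascPochhammer_eval_mul_Gamma hb1, ascPochhammer_eval_one, Real.Gamma_one]
  field_simp

theorem integral_binomial_betaMeasure {a b : ℝ} (ha : 0 < a) (hb : 0 < b) {m r : ℕ}
    (hr : r ≤ m) :
    ∫ v, (m.choose r : ℝ) * v ^ r * (1 - v) ^ (m - r) ∂betaMeasure a b = betaBinomial m a b r := by
  simp only [mul_assoc]
  rw [integral_const_mul, integral_pow_mul_pow_betaMeasure ha hb, betaBinomial, mul_div_assoc,
    Nat.cast_sub hr, add_sub_assoc]

theorem betaBinomial_one {b : ℝ} (hb : 0 < b) (m r : ℕ) :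
    betaBinomial m 1 b r = (m.choose r : ℝ) * b
      * (Real.Gamma (r + 1) * Real.Gamma (b + m - r) / Real.Gamma (b + m + 1)) := by
  have hsum : (1 : ℝ) + r + (b + m - r) = b + m + 1 := by ring
  have hΓ := (Real.Gamma_pos_of_pos hb).ne'
  have hΓ' : Real.Gamma (b + m + 1) ≠ 0 := (Real.Gamma_pos_of_pos (by positivity)).ne'
  rw [betaBinomial, beta, beta, hsum, add_comm (1 : ℝ) b, Real.Gamma_add_one hb.ne',
    Real.Gamma_one, add_comm (1 : ℝ) r]
  field_simp

/-! ### The Dirichlet distribution -/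

theorem measurePreserving_pi_eval_pair {ι : Type*} [Fintype ι] {X : ι → Type*}
    [∀ i, MeasurableSpace (X i)] (ν : ∀ i, Measure (X i)) [∀ i, IsProbabilityMeasure (ν i)]
    {i j : ι} (hij : i ≠ j) :
    MeasurePreserving (fun y : ∀ i, X i => (y i, y j)) (Measure.pi ν) ((ν i).prod (ν j)) := by
  have hindep := (iIndepFun_pi (μ := ν) (X := fun _ x => x) fun _ => aemeasurable_id).indepFun hij
  refine ⟨by fun_prop, ?_⟩
  have := (indepFun_iff_map_prod_eq_prod_map_map (measurable_pi_apply i).aemeasurable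
    (measurable_pi_apply j).aemeasurable).1 hindep
  simpa only [(measurePreserving_eval ν _).map_eq] using this

theorem integral_div_add_pow_dirichletLaw {m : ℕ} {α : Fin m → ℝ} (hα : ∀ i, 0 ≤ α i)
    {i j : Fin m} (hij : i ≠ j) (hpos : 0 < α i + α j) (k : ℕ) :
    ∫ y, (y i / (y i + y j)) ^ k ∂dirichletLaw α
      = (ascPochhammer ℝ k).eval (α i) / (ascPochhammer ℝ k).eval (α i + α j) := by
  have := fun i => isProbabilityMeasure_gammaLaw (hα i)
  have hnn : ∀ᵐ y ∂Measure.pi fun i => gammaLaw (α i), ∀ i, 0 ≤ y i :=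
    ae_all_iff.2 fun i =>
      (measurePreserving_eval (fun i => gammaLaw (α i)) i).quasiMeasurePreserving.ae
        (ae_nonneg_gammaLaw (hα i))
  have hpair := measurePreserving_pi_eval_pair (fun i => gammaLaw (α i)) hij
  rw [← integral_div_add_pow_gammaLaw_prod (hα i) (hα j) hpos k, ← hpair.map_eq,
    integral_map (by fun_prop) (Measurable.aestronglyMeasurable (by fun_prop)), dirichletLaw,
    integral_map (by fun_prop) (Measurable.aestronglyMeasurable (by fun_prop))]
  refine integral_congr_ae ?_
  filter_upwards [hnn] with y hy
  rcases (Finset.sum_nonneg fun i (_ : i ∈ Finset.univ) => hy i).eq_or_lt with h0 | h0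
  · have := (Finset.sum_eq_zero_iff_of_nonneg fun i (_ : i ∈ Finset.univ) => hy i).1 h0.symm
    simp [this]
  · rw [← add_div, div_div_div_cancel_right₀ h0.ne']

/-! ### Relative masses under a Dirichlet process -/

section DirichletProcess

variable {Ω S : Type*} [MeasurableSpace Ω] [MeasurableSpace S] {μ : Measure Ω}
  {P : Ω → Measure S} {θ : ℝ} {G₀ : Measure S} {A B : Set S}

theorem IsDirichletProcess.measurable_measureReal (hP : IsDirichletProcess μ P θ G₀)
    (hA : MeasurableSet A) : Measurable fun ω => (P ω).real A :=
  ((Measure.measurable_coe hA).comp hP.measurable).ennreal_toReal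

theorem IsDirichletProcess.integral_div_pow [IsFiniteMeasure G₀]
    (hP : IsDirichletProcess μ P θ G₀) (hθ : 0 < θ) (hA : MeasurableSet A)
    (hB : MeasurableSet B) (hAB : A ⊆ B) (hB0 : 0 < G₀.real B) (k : ℕ) :
    ∫ ω, ((P ω).real A / (P ω).real B) ^ k ∂μ
      = (ascPochhammer ℝ k).eval (θ * G₀.real A) / (ascPochhammer ℝ k).eval (θ * G₀.real B) := by
  have := hP.isProbabilityMeasure
  let E : Fin 3 → Set S := ![A, B \ A, Bᶜ]
  have hE : ∀ i, MeasurableSet (E i) := by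
    simp [Fin.forall_fin_succ, E, hA, hB, hB.diff hA]
  have hdisj : Pairwise fun i i' => Disjoint (E i) (E i') := by
    have h1 : Disjoint A (B \ A) := Set.disjoint_sdiff_right
    have h2 : Disjoint A Bᶜ := Set.disjoint_compl_right_iff_subset.2 hAB
    have h3 : Disjoint (B \ A) Bᶜ := Set.disjoint_compl_right_iff_subset.2 Set.sdiff_subset
    intro i i' hii
    fin_cases i <;> fin_cases i' <;> simp_all [E, disjoint_comm]
  have huniv : (⋃ i, E i) = Set.univ := by
    ext s
    by_cases hs : s ∈ B <;> simp [E, Fin.exists_fin_succ, hs, em]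
  have hsum (p : Measure S) [IsFiniteMeasure p] : p.real A + p.real (B \ A) = p.real B := by
    rw [measureReal_sdiff hAB hA, add_sub_cancel]
  have hratio := integral_div_add_pow_dirichletLaw (α := fun i => θ * G₀.real (E i))
    (fun i => by positivity) (i := 0) (j := 1) (by decide)
    (by simpa [E, ← mul_add, hsum] using mul_pos hθ hB0) k
  rw [← hP.map_partition 3 E hE hdisj huniv, integral_map
    (measurable_pi_lambda _ fun i => hP.measurable_measureReal (hE i)).aemeasurable
    (Measurable.aestronglyMeasurable (by fun_prop))] at hratio
  simpa only [E, Matrix.cons_val_zero, Matrix.cons_val_one, ← mul_add, hsum] using hratio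

theorem IsDirichletProcess.ae_ne_zero [IsFiniteMeasure G₀] [IsProbabilityMeasure μ]
    (hP : IsDirichletProcess μ P θ G₀) (hθ : 0 < θ) (hB : MeasurableSet B)
    (hB0 : 0 < G₀.real B) : ∀ᵐ ω ∂μ, P ω B ≠ 0 := by
  have := hP.isProbabilityMeasure
  have hms : MeasurableSet {ω | P ω B ≠ 0} :=
    ((Measure.measurable_coe hB).comp hP.measurable) (measurableSet_singleton 0).compl
  have hind : ∀ ω, ((P ω).real B / (P ω).real B) ^ 1 = {ω | P ω B ≠ 0}.indicator 1 ω := fun ω => by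
    by_cases h : P ω B = 0
    · simp [measureReal_def, h]
    · simp [h, div_self (measureReal_ne_zero_iff (μ := P ω) |>.2 h)]
  have hone := hP.integral_div_pow hθ hB hB subset_rfl hB0 1
  rw [div_self (ascPochhammer_pos 1 _ (mul_pos hθ hB0)).ne'] at hone
  simp only [hind, integral_indicator_one hms] at hone
  exact (mem_ae_iff_prob_eq_one hms).2 ((ENNReal.toReal_eq_one_iff _).1 hone)

end DirichletProcess

/-! ### Atoms as limits of refining partitions -/

section CountablySeparated

variable {S : Type*} [MeasurableSpace S]

theorem measurableEq_of_countablySeparated [MeasurableSpace.CountablySeparated S] :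
    MeasurableEq S := by
  obtain ⟨f, hf, hinj⟩ := MeasurableSpace.measurable_injection_nat_bool_of_countablySeparated S
  refine ⟨?_⟩
  have := measurableSet_eq_fun (hf.comp (measurable_fst (α := S) (β := S)))
    (hf.comp (measurable_snd (α := S) (β := S)))
  convert this using 1
  ext p
  simp [hinj.eq_iff]

/-- The first `m` bits of the binary code `f s` of a point `s`. Its fibres, for `m = 0, 1, …`, are
a refining sequence of finite partitions of `S`. -/
def label (f : S → ℕ → Bool) (m : ℕ) (s : S) : Fin m → Bool := fun i => f s i

variable {f : S → ℕ → Bool}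

theorem measurable_label (hf : Measurable f) (m : ℕ) : Measurable (label f m) :=
  measurable_pi_lambda _ fun i => (measurable_pi_apply (i : ℕ)).comp hf

theorem measurableSet_label_fiber (hf : Measurable f) (m : ℕ) (w : Fin m → Bool) :
    MeasurableSet (label f m ⁻¹' {w}) :=
  measurable_label hf m (measurableSet_singleton w)

theorem tendsto_measureReal_label_fiber (hf : Measurable f) (hinj : Function.Injective f)
    (ν : Measure S) [IsFiniteMeasure ν] (s : S) :
    Tendsto (fun m => ν.real (label f m ⁻¹' {label f m s})) atTop (𝓝 (ν.real {s})) := by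
  have hs : ({s} : Set S) = ⋂ m, label f m ⁻¹' {label f m s} := by
    ext t
    simp only [Set.mem_singleton_iff, Set.mem_iInter, Set.mem_preimage]
    refine ⟨fun h m => by rw [h], fun h => hinj (funext fun i => ?_)⟩
    exact congrFun (h (i + 1)) ⟨i, i.lt_succ_self⟩
  have hanti : Antitone fun m => label f m ⁻¹' {label f m s} :=
    fun m m' hm t ht => funext fun i => congrFun ht (Fin.castLE hm i)
  rw [hs]
  exact (ENNReal.tendsto_toReal (measure_ne_top _ _)).comp <| tendsto_measure_iInter_atTop
    (fun m => (measurableSet_label_fiber hf m _).nullMeasurableSet) hanti ⟨0, measure_ne_top _ _⟩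

theorem integral_comp_eq_sum_fiber {ι : Type*} [Fintype ι] [MeasurableSpace ι]
    [MeasurableSingletonClass ι] {g : S → ι} (hg : Measurable g) (ν : Measure S)
    [IsFiniteMeasure ν] (φ : ι → ℝ) :
    ∫ s, φ (g s) ∂ν = ∑ w, ν.real (g ⁻¹' {w}) * φ w := by
  rw [← integral_map hg.aemeasurable (Measurable.of_discrete).aestronglyMeasurable,
    integral_fintype (.of_finite)]
  simp only [map_measureReal_apply hg (measurableSet_singleton _), smul_eq_mul]

theorem norm_sum_fiber_mul_pow_le_one {ι : Type*} [Fintype ι] [MeasurableSpace ι]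
    [MeasurableSingletonClass ι] {g : S → ι} (hg : Measurable g) (ν : Measure S)
    [IsZeroOrProbabilityMeasure ν] (k : ℕ) :
    ‖∑ w, ν.real (g ⁻¹' {w}) * ν.real (g ⁻¹' {w}) ^ k‖ ≤ 1 := by
  rw [← integral_comp_eq_sum_fiber hg ν fun w => ν.real (g ⁻¹' {w}) ^ k]
  refine (norm_integral_le_of_norm_le_const (C := 1) (ae_of_all _ fun s => ?_)).trans ?_
  · rw [norm_pow, Real.norm_of_nonneg measureReal_nonneg]
    exact pow_le_one₀ measureReal_nonneg measureReal_le_one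
  · rw [one_mul]
    exact measureReal_le_one

theorem tendsto_sum_label_fiber (hf : Measurable f) (hinj : Function.Injective f) (ν : Measure S)
    [IsFiniteMeasure ν] {ψ : ℝ → ℝ} (hψ : Continuous ψ) :
    Tendsto (fun m => ∑ w, ν.real (label f m ⁻¹' {w}) * ψ (ν.real (label f m ⁻¹' {w}))) atTop
      (𝓝 (∫ s, ψ (ν.real {s}) ∂ν)) := by
  obtain ⟨C, hC⟩ := (isCompact_Icc (a := 0) (b := ν.real Set.univ)).exists_bound_of_continuousOn
    hψ.continuousOn
  simp only [← integral_comp_eq_sum_fiber (measurable_label hf _) ν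
    fun w => ψ (ν.real (label f _ ⁻¹' {w}))]
  refine tendsto_integral_of_dominated_convergence (fun _ => C) (fun m => ?_)
    (integrable_const C) (fun m => ae_of_all _ fun s => ?_) (ae_of_all _ fun s => ?_)
  · exact ((Measurable.of_discrete (f := fun w => ψ (ν.real (label f m ⁻¹' {w})))).comp
      (measurable_label hf m)).aestronglyMeasurable
  · exact hC _ ⟨measureReal_nonneg, measureReal_mono (Set.subset_univ _)⟩
  · exact (hψ.tendsto _).comp (tendsto_measureReal_label_fiber hf hinj ν s)

end CountablySeparated

/-! ### The atoms of a normalized restriction of a Dirichlet process -/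

section Atoms

variable {Ω S : Type*} [MeasurableSpace Ω] [MeasurableSpace S] {μ : Measure Ω}
  {P : Ω → Measure S} {θ : ℝ} {G₀ : Measure S} {B : Set S}

theorem ascPochhammer_succ_eval_left (a : ℝ) (k : ℕ) :
    (ascPochhammer ℝ (k + 1)).eval a = a * (ascPochhammer ℝ k).eval (a + 1) := by
  simp [ascPochhammer_succ_left]

theorem cond_measureReal (hB : MeasurableSet B) (p : Measure S) (A : Set S) :
    p[|B].real A = p.real (B ∩ A) / p.real B := by
  rw [measureReal_def, cond_apply hB, ENNReal.toReal_mul, ENNReal.toReal_inv, inv_mul_eq_div,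
    measureReal_def, measureReal_def]

theorem IsDirichletProcess.measurable_cond_measureReal (hP : IsDirichletProcess μ P θ G₀)
    (hB : MeasurableSet B) {A : Set S} (hA : MeasurableSet A) :
    Measurable fun ω => (P ω)[|B].real A := by
  simp only [cond_measureReal hB]
  exact (hP.measurable_measureReal (hB.inter hA)).div (hP.measurable_measureReal hB)

theorem IsDirichletProcess.integral_sum_label_fiber_pow [IsFiniteMeasure G₀]
    [IsProbabilityMeasure μ] (hP : IsDirichletProcess μ P θ G₀) (hθ : 0 < θ)
    (hB : MeasurableSet B) (hB0 : 0 < G₀.real B) {f : S → ℕ → Bool} (hf : Measurable f)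
    (m k : ℕ) :
    ∫ ω, ∑ w, (P ω)[|B].real (label f m ⁻¹' {w}) * (P ω)[|B].real (label f m ⁻¹' {w}) ^ k ∂μ
      = ∑ w, (G₀.restrict B).real (label f m ⁻¹' {w})
        * (θ * (ascPochhammer ℝ k).eval (θ * (G₀.restrict B).real (label f m ⁻¹' {w}) + 1)
          / (ascPochhammer ℝ (k + 1)).eval (θ * G₀.real B)) := by
  have := hP.isProbabilityMeasure
  have hcell := measurableSet_label_fiber hf m
  rw [integral_finsetSum _ fun w _ => ?_]
  · refine Finset.sum_congr rfl fun w _ => ?_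
    simp only [← pow_succ', cond_measureReal hB]
    rw [hP.integral_div_pow hθ (hB.inter (hcell w)) hB Set.inter_subset_left hB0,
      measureReal_restrict_apply (hcell w), Set.inter_comm,
      ascPochhammer_succ_eval_left (θ * G₀.real (_ ∩ _))]
    ring
  · simp only [← pow_succ']
    refine Integrable.of_bound (C := 1)
      ((hP.measurable_cond_measureReal hB (hcell w)).pow_const _).aestronglyMeasurable
      (ae_of_all _ fun ω => ?_)
    rw [norm_pow, Real.norm_of_nonneg measureReal_nonneg]
    exact pow_le_one₀ measureReal_nonneg measureReal_le_one

-- Over a fine partition, the sums of `P_B (cell) ^ (k + 1)` converge to the `k`-th moment of the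
-- mass of a point drawn from `P_B = P[|B]`, while their means become an integral over `G₀`.
theorem IsDirichletProcess.integral_integral_cond_singleton_pow
    [MeasurableSpace.CountablySeparated S] [IsFiniteMeasure G₀] [NullSingletonClass G₀]
    [IsProbabilityMeasure μ]
    (hP : IsDirichletProcess μ P θ G₀) (hθ : 0 < θ) (hB : MeasurableSet B)
    (hB0 : 0 < G₀.real B) (k : ℕ) :
    ∫ ω, ∫ s, (P ω)[|B].real {s} ^ k ∂(P ω)[|B] ∂μ
      = k.factorial / (ascPochhammer ℝ k).eval (θ * G₀.real B + 1) := by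
  have := hP.isProbabilityMeasure
  obtain ⟨f, hf, hinj⟩ := MeasurableSpace.measurable_injection_nat_bool_of_countablySeparated S
  have hmeas (m w) : Measurable fun ω => (P ω)[|B].real (label f m ⁻¹' {w}) :=
    hP.measurable_cond_measureReal hB (measurableSet_label_fiber hf m w)
  have hleft : Tendsto (fun m => ∫ ω, ∑ w, (P ω)[|B].real (label f m ⁻¹' {w})
      * (P ω)[|B].real (label f m ⁻¹' {w}) ^ k ∂μ) atTop
      (𝓝 (∫ ω, ∫ s, (P ω)[|B].real {s} ^ k ∂(P ω)[|B] ∂μ)) :=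
    tendsto_integral_of_dominated_convergence (fun _ => 1)
      (fun m => (Finset.measurable_fun_sum Finset.univ fun w _ =>
        (hmeas m w).mul ((hmeas m w).pow_const k)).aestronglyMeasurable)
      (integrable_const 1) (fun m => ae_of_all _ fun ω =>
        norm_sum_fiber_mul_pow_le_one (measurable_label hf m) (P ω)[|B] k)
      (ae_of_all _ fun ω => tendsto_sum_label_fiber hf hinj (P ω)[|B] (continuous_pow k))
  have hright := tendsto_sum_label_fiber hf hinj (G₀.restrict B) (ψ := fun x =>
    θ * (ascPochhammer ℝ k).eval (θ * x + 1) / (ascPochhammer ℝ (k + 1)).eval (θ * G₀.real B))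
    (by fun_prop)
  simp only [hP.integral_sum_label_fiber_pow hθ hB hB0 hf] at hleft
  rw [tendsto_nhds_unique hleft hright]
  simp only [measureReal_def, measure_singleton, ENNReal.toReal_zero, mul_zero, zero_add,
    ascPochhammer_eval_one, integral_const, Measure.restrict_apply_univ, smul_eq_mul,
    ascPochhammer_succ_eval_left]
  rw [measureReal_def] at hB0
  field_simp

end Atoms

/-! ### Conditioned measures -/

section Conditioning

variable {α β : Type*} [MeasurableSpace α] [MeasurableSpace β] {ν : Measure α} {ρ : Measure β}

theorem measurable_cond {s : Set β} {P : α → Measure β} (hP : Measurable P)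
    (hs : MeasurableSet s) : Measurable fun a => (P a)[|s] := by
  refine Measure.measurable_of_measurable_coe _ fun t ht => ?_
  simp only [cond_apply hs]
  exact ((Measure.measurable_coe hs).comp hP).inv.mul
    ((Measure.measurable_coe (hs.inter ht)).comp hP)

theorem cond_pi_univ_pi {ι : Type*} [Fintype ι] {X : ι → Type*} [∀ i, MeasurableSpace (X i)]
    (ν : ∀ i, Measure (X i)) [∀ i, IsFiniteMeasure (ν i)] {B : ∀ i, Set (X i)}
    (hB : ∀ i, MeasurableSet (B i)) :
    (Measure.pi ν)[|Set.univ.pi B] = Measure.pi fun i => (ν i)[|B i] := by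
  refine (Measure.pi_eq fun A _ => ?_).symm
  simp only [cond_apply (MeasurableSet.univ_pi hB), ← Set.pi_inter_distrib, Measure.pi_pi,
    cond_apply (hB _), Finset.prod_mul_distrib]
  rw [ENNReal.prod_inv_distrib fun i _ i' _ _ => .inr (measure_ne_top _ _)]

theorem cond_prod_prod [IsFiniteMeasure ν] [IsFiniteMeasure ρ] (s : Set α) (t : Set β) :
    (ν.prod ρ)[|s ×ˢ t] = ν[|s].prod ρ[|t] := by
  simp only [ProbabilityTheory.cond]
  rw [Measure.prod_prod, ← Measure.prod_restrict, Measure.prod_smul_left,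
    Measure.prod_smul_right, smul_smul,
    ENNReal.mul_inv (.inr (measure_ne_top _ _)) (.inl (measure_ne_top _ _))]

theorem prod_measureReal_eq_integral [IsFiniteMeasure ρ] {E : Set (α × β)}
    (hE : MeasurableSet E) : (ν.prod ρ).real E = ∫ x, ρ.real (Prod.mk x ⁻¹' E) ∂ν := by
  rw [measureReal_def, Measure.prod_apply hE]
  exact (integral_toReal (measurable_measure_prodMk_left hE).aemeasurable
    (ae_of_all _ fun _ => measure_lt_top _ _)).symm

theorem measurePreserving_cond_preimage {e : α → β} (he : MeasurePreserving e ν ρ) {s : Set β}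
    (hs : MeasurableSet s) : MeasurePreserving e ν[|e ⁻¹' s] ρ[|s] := by
  simp only [ProbabilityTheory.cond, he.measure_preimage hs.nullMeasurableSet]
  exact (he.restrict_preimage hs).smul_measure _

theorem cond_preimage_measureReal_eq_of_forall_fiber {ι : Type*} [MeasurableSpace ι]
    [MeasurableSingletonClass ι] [IsFiniteMeasure ν] {φ : α → ι} (hφ : Measurable φ)
    {E : Finset ι} (hE : ν.real (φ ⁻¹' E) ≠ 0) {t : Set α} {b : ℝ}
    (hb : ∀ w ∈ E, ν.real (φ ⁻¹' {w}) ≠ 0 → ν[|φ ⁻¹' {w}].real t = b) :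
    ν[|φ ⁻¹' E].real t = b := by
  have hfiber (w) : MeasurableSet (φ ⁻¹' {w}) := hφ (measurableSet_singleton w)
  have hEm : MeasurableSet (φ ⁻¹' E) := hφ E.measurableSet
  rw [cond_measureReal hEm, div_eq_iff hE, ← measureReal_restrict_apply hEm,
    ← sum_measureReal_preimage_singleton E fun w _ => hfiber w,
    ← sum_measureReal_preimage_singleton E fun w _ => hfiber w, Finset.mul_sum]
  refine Finset.sum_congr rfl fun w hw => ?_
  rw [measureReal_restrict_apply (hfiber w)]
  by_cases h0 : ν.real (φ ⁻¹' {w}) = 0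
  · rw [h0, mul_zero, measureReal_mono_null Set.inter_subset_left h0]
  · rw [← hb w hw h0, cond_measureReal (hfiber w), div_mul_cancel₀ _ h0]

theorem integral_natCast_eq_sum [IsFiniteMeasure ν] {f : α → ℕ} (hf : Measurable f) {N : ℕ}
    (hN : ∀ x, f x ≤ N) :
    ∫ x, (f x : ℝ) ∂ν = ∑ r ∈ Finset.range (N + 1), (r : ℝ) * ν.real {x | f x = r} := by
  have hmeas (r : ℕ) : MeasurableSet {x | f x = r} := hf (measurableSet_singleton r)
  have hdecomp (x : α) : (f x : ℝ)
      = ∑ r ∈ Finset.range (N + 1), {x | f x = r}.indicator (fun _ => (r : ℝ)) x := by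
    simp [Set.indicator_apply, hN x]
  simp only [hdecomp]
  rw [integral_finsetSum _ fun r _ => (integrable_const _).indicator (hmeas r)]
  refine Finset.sum_congr rfl fun r _ => ?_
  rw [integral_indicator_const _ (hmeas r), smul_eq_mul, mul_comm]

end Conditioning

/-! ### The frequency of a symbol, given the sketch -/

section Sampling

variable {S : Type*} {J n : ℕ}

/-- The positions at which the symbol `s` occurs in the sample `x`; the event that they form a
given set is a box. -/
noncomputable def occurrences (s : S) (x : Fin n → S) : Finset (Fin n) :=
  open Classical in Finset.univ.filter fun i => x i = s

theorem occurrences_preimage_singleton (s : S) (W : Finset (Fin n)) :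
    occurrences s ⁻¹' {W} = Set.univ.pi fun i => if i ∈ W then {s} else {s}ᶜ := by
  ext x
  simp only [occurrences, Set.mem_preimage, Set.mem_singleton_iff, Finset.ext_iff,
    Finset.mem_filter, Finset.mem_univ, true_and, Set.mem_univ_pi]
  refine forall_congr' fun i => ?_
  by_cases hi : i ∈ W <;> simp [hi]

theorem prod_ite_mem_ite_mem {T W : Finset (Fin n)} (v : ℝ) :
    ∏ i, (if i ∈ W then (if i ∈ T then v else 0) else 1 - (if i ∈ T then v else 0))
      = if W ⊆ T then v ^ W.card * (1 - v) ^ (T.card - W.card) else 0 := by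
  split_ifs with hWT
  · have hfactor (i : Fin n) :
        (if i ∈ W then (if i ∈ T then v else 0) else 1 - (if i ∈ T then v else 0))
          = (if i ∈ W then v else 1) * if i ∈ T \ W then 1 - v else 1 := by
      by_cases hW : i ∈ W
      · simp [hW, hWT hW]
      · by_cases hT : i ∈ T <;> simp [hW, hT]
    simp only [hfactor, Finset.prod_mul_distrib, Finset.prod_ite_mem, Finset.univ_inter,
      Finset.prod_const, Finset.card_sdiff_of_subset hWT]
  · obtain ⟨i, hW, hT⟩ := Finset.not_subset.1 hWT
    exact Finset.prod_eq_zero (Finset.mem_univ i) (by simp [hW, hT])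

theorem comp_preimage_singleton (g : S → Fin J) (σ : Fin n → Fin J) :
    (g ∘ ·) ⁻¹' {σ} = Set.univ.pi fun i => bucket g (σ i) := by
  ext x
  simp [bucket, funext_iff]

theorem setOf_sketch_eq_preimage (g : S → Fin J) (c : Fin J → ℕ) :
    {x : Fin n → S | sketch g x = c}
      = (g ∘ ·) ⁻¹' (Finset.univ.filter fun σ : Fin n → Fin J => sketch id σ = c : Finset _) := by
  ext x
  simp only [Set.mem_preimage, Finset.coe_filter, Finset.mem_univ, true_and, Set.mem_ofPred_eq]
  rfl

theorem exists_sketch_id_eq {c : Fin J → ℕ} (hc : ∑ i, c i = n) :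
    ∃ σ : Fin n → Fin J, sketch id σ = c := by
  subst hc
  refine ⟨fun i => (finSigmaFinEquiv.symm i).1, funext fun j => ?_⟩
  calc (Finset.univ.filter fun i => (finSigmaFinEquiv.symm i).1 = j).card
    _ = ((Finset.univ : Finset (Fin (c j))).map
          ((Function.Embedding.sigmaMk j).trans finSigmaFinEquiv.toEmbedding)).card := by
        congr 1
        ext i
        obtain ⟨⟨j', k⟩, rfl⟩ := finSigmaFinEquiv.surjective i
        simp only [Finset.mem_filter, Finset.mem_univ, true_and, Equiv.symm_apply_apply,
          Finset.mem_map, Function.Embedding.trans_apply, Function.Embedding.sigmaMk_apply,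
          Equiv.coe_toEmbedding, EmbeddingLike.apply_eq_iff_eq]
        constructor
        · rintro rfl
          exact ⟨k, rfl⟩
        · rintro ⟨k', hk'⟩
          exact (congrArg Sigma.fst hk').symm
    _ = c j := by rw [Finset.card_map, Finset.card_univ, Fintype.card_fin]

variable [MeasurableSpace S]

theorem pi_measureReal_freq_eq [MeasurableSingletonClass S] (ν : Fin n → Measure S)
    [∀ i, IsProbabilityMeasure (ν i)] {s : S} {T : Finset (Fin n)} {v : ℝ}
    (hv : ∀ i, (ν i).real {s} = if i ∈ T then v else 0) (r : ℕ) :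
    (Measure.pi ν).real {x | freq x s = r}
      = T.card.choose r * v ^ r * (1 - v) ^ (T.card - r) := by
  have hbox (W : Finset (Fin n)) : (Measure.pi ν).real (occurrences s ⁻¹' {W})
      = if W ⊆ T then v ^ W.card * (1 - v) ^ (T.card - W.card) else 0 := by
    rw [occurrences_preimage_singleton, measureReal_def, Measure.pi_pi, ENNReal.toReal_prod,
      ← prod_ite_mem_ite_mem]
    refine Finset.prod_congr rfl fun i _ => ?_
    rw [← hv i]
    split_ifs
    · rfl
    · exact probReal_compl_eq_one_sub (measurableSet_singleton s)
  have hmeas (W : Finset (Fin n)) : MeasurableSet (occurrences s ⁻¹' {W}) := by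
    rw [occurrences_preimage_singleton]
    exact MeasurableSet.univ_pi fun i => by split_ifs <;> measurability
  calc (Measure.pi ν).real {x | freq x s = r}
    _ = (Measure.pi ν).real (occurrences s ⁻¹'
        (Finset.univ.powersetCard r : Finset (Finset (Fin n)))) := by
        congr 1
        ext x
        simp [freq, occurrences]
    _ = ∑ W ∈ T.powersetCard r, v ^ r * (1 - v) ^ (T.card - r) := by
        rw [← sum_measureReal_preimage_singleton _ fun W _ => hmeas W]
        simp only [hbox]
        rw [← Finset.sum_filter]
        refine Finset.sum_congr ?_ ?_
        · ext W
          simp [Finset.mem_powersetCard, and_comm]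
        · intro W hW
          rw [(Finset.mem_powersetCard.1 hW).2]
    _ = _ := by rw [Finset.sum_const, Finset.card_powersetCard, nsmul_eq_mul, mul_assoc]

variable {g : S → Fin J} {p : Measure S} {c : Fin J → ℕ}

theorem measurableSet_bucket (hg : Measurable g) (j : Fin J) : MeasurableSet (bucket g j) :=
  hg (measurableSet_singleton j)

theorem bucketLaw_real_singleton (hg : Measurable g) (p : Measure S) (i : Fin J) (s : S) :
    (bucketLaw g i p).real {s} = if i = g s then (bucketLaw g (g s) p).real {s} else 0 := by
  split_ifs with h
  · rw [h]
  · have hdisj : bucket g i ∩ {s} = ∅ :=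
      Set.disjoint_iff_inter_eq_empty.1 (Set.disjoint_singleton_right.2 (Ne.symm h))
    rw [bucketLaw, cond_measureReal (measurableSet_bucket hg i), hdisj, measureReal_empty,
      zero_div]

theorem cond_comp_measureReal_freq_eq [MeasurableSingletonClass S] (hg : Measurable g)
    [IsFiniteMeasure p] {σ : Fin n → Fin J} (hp : ∀ i, p (bucket g (σ i)) ≠ 0) (s : S)
    (r : ℕ) :
    (Measure.pi fun _ : Fin n => p)[|(g ∘ ·) ⁻¹' {σ}].real {x | freq x s = r}
      = (sketch id σ (g s)).choose r * (bucketLaw g (g s) p).real {s} ^ r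
        * (1 - (bucketLaw g (g s) p).real {s}) ^ (sketch id σ (g s) - r) := by
  have (i : Fin n) : IsProbabilityMeasure p[|bucket g (σ i)] := cond_isProbabilityMeasure (hp i)
  rw [comp_preimage_singleton, cond_pi_univ_pi _ fun i => measurableSet_bucket hg (σ i)]
  refine pi_measureReal_freq_eq _ (T := Finset.univ.filter fun i => σ i = g s) (fun i => ?_) r
  simpa using! bucketLaw_real_singleton hg p (σ i) s

theorem pi_measureReal_sketch_ne_zero [IsFiniteMeasure p]
    (hp : ∀ j, p (bucket g j) ≠ 0) (hc : ∑ i, c i = n) :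
    (Measure.pi fun _ : Fin n => p).real {x | sketch g x = c} ≠ 0 := by
  obtain ⟨σ, hσ⟩ := exists_sketch_id_eq hc
  have hsub : (g ∘ ·) ⁻¹' {σ} ⊆ {x : Fin n → S | sketch g x = c} := by
    rintro x rfl
    exact hσ
  refine fun h => ?_
  have := measureReal_mono_null hsub h
  rw [comp_preimage_singleton, measureReal_def, Measure.pi_pi, ENNReal.toReal_prod] at this
  exact Finset.prod_ne_zero_iff.2
    (fun i _ => ENNReal.toReal_ne_zero.2 ⟨hp (σ i), measure_ne_top _ _⟩) this

theorem cond_sketch_measureReal_freq_eq [MeasurableSingletonClass S] [IsFiniteMeasure p]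
    (hg : Measurable g) (hp : ∀ j, p (bucket g j) ≠ 0) (hc : ∑ i, c i = n) (s : S) (r : ℕ) :
    (Measure.pi fun _ : Fin n => p)[|{x | sketch g x = c}].real {x | freq x s = r}
      = (c (g s)).choose r * (bucketLaw g (g s) p).real {s} ^ r
        * (1 - (bucketLaw g (g s) p).real {s}) ^ (c (g s) - r) := by
  have hcomp : Measurable fun x : Fin n → S => g ∘ x := by fun_prop
  have hE := pi_measureReal_sketch_ne_zero hp hc
  rw [setOf_sketch_eq_preimage] at hE ⊢
  refine cond_preimage_measureReal_eq_of_forall_fiber hcomp hE fun σ hσ _ => ?_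
  rw [cond_comp_measureReal_freq_eq hg (fun i => hp (σ i)), (Finset.mem_filter.1 hσ).2]

theorem measurable_sketch (hg : Measurable g) :
    Measurable fun x : Fin n → S => sketch g x := by
  have hcomp : Measurable fun x : Fin n → S => g ∘ x := by fun_prop
  exact (measurable_of_finite (sketch id)).comp hcomp

theorem measurable_freq [MeasurableEq S] :
    Measurable fun q : S × (Fin n → S) => freq q.2 q.1 := by
  simp only [freq, Finset.card_filter]
  exact Finset.measurable_fun_sum _ fun i _ =>
    Measurable.ite (measurableSet_eq_fun ((measurable_pi_apply i).comp measurable_snd)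
      measurable_fst) measurable_const measurable_const

theorem measurePreserving_condSample [IsFiniteMeasure p] (hg : Measurable g) (c : Fin J → ℕ)
    (j : Fin J) :
    MeasurePreserving (MeasurableEquiv.piFinSuccAbove (fun _ => S) (Fin.last n))
      (condSample g n c j p)
      ((bucketLaw g j p).prod (Measure.pi fun _ : Fin n => p)[|{x | sketch g x = c}]) := by
  have hmeas : MeasurableSet (bucket g j ×ˢ {x : Fin n → S | sketch g x = c}) :=
    (measurableSet_bucket hg j).prod (measurable_sketch hg (measurableSet_singleton c))
  have hevent : {x : Fin (n + 1) → S | sketch g (Fin.init x) = c ∧ g (x (Fin.last n)) = j}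
      = MeasurableEquiv.piFinSuccAbove (fun _ => S) (Fin.last n) ⁻¹'
        (bucket g j ×ˢ {x | sketch g x = c}) := by
    ext x
    simp [bucket, and_comm]
  rw [condSample, hevent, bucketLaw, ← cond_prod_prod]
  exact measurePreserving_cond_preimage
    (measurePreserving_piFinSuccAbove (fun _ : Fin (n + 1) => p) (Fin.last n)) hmeas

theorem freqProb_eq_integral [MeasurableEq S] [IsFiniteMeasure p] (hg : Measurable g)
    (hp : ∀ j, p (bucket g j) ≠ 0) (hc : ∑ i, c i = n) (j : Fin J) (r : ℕ) :
    freqProb g n c j r p = ∫ s, ((c j).choose r : ℝ) * (bucketLaw g j p).real {s} ^ r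
      * (1 - (bucketLaw g j p).real {s}) ^ (c j - r) ∂bucketLaw g j p := by
  have hF : MeasurableSet {q : S × (Fin n → S) | freq q.2 q.1 = r} :=
    measurable_freq (measurableSet_singleton r)
  have hbucket : ∀ᵐ s ∂bucketLaw g j p, g s = j :=
    ae_cond_mem (measurableSet_bucket hg j)
  calc freqProb g n c j r p
    _ = ((bucketLaw g j p).prod (Measure.pi fun _ : Fin n => p)[|{x | sketch g x = c}]).real
          {q | freq q.2 q.1 = r} := by
        rw [← (measurePreserving_condSample hg c j).measureReal_preimage hF.nullMeasurableSet]
        rw [freqProb]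
        congr 1
        ext x
        simp
    _ = ∫ s, (Measure.pi fun _ : Fin n => p)[|{x | sketch g x = c}].real {x | freq x s = r}
          ∂bucketLaw g j p := prod_measureReal_eq_integral hF
    _ = _ := by
        refine integral_congr_ae ?_
        filter_upwards [hbucket] with s hs
        rw [cond_sketch_measureReal_freq_eq hg hp hc, hs]

theorem sum_mul_binomial {m N : ℕ} (hmN : m ≤ N) (v : ℝ) :
    ∑ r ∈ Finset.range (N + 1), (r : ℝ) * (m.choose r * v ^ r * (1 - v) ^ (m - r)) = m * v := by
  rw [← Finset.sum_subset (Finset.range_subset_range.2 (Nat.succ_le_succ hmN))]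
  · have hmean := congrArg (Polynomial.eval v) (bernsteinPolynomial.sum_smul ℝ m)
    simpa [Polynomial.eval_finsetSum, bernsteinPolynomial, nsmul_eq_mul] using hmean
  · intro r _ hr
    rw [Finset.mem_range, not_lt] at hr
    rw [Nat.choose_eq_zero_of_lt hr]
    simp

theorem freqMean_eq_sum [MeasurableEq S] (g : S → Fin J) (n : ℕ) (c : Fin J → ℕ) (j : Fin J)
    (p : Measure S) :
    freqMean g n c j p = ∑ r ∈ Finset.range (n + 1), (r : ℝ) * freqProb g n c j r p := by
  have hmeas : Measurable fun x : Fin (n + 1) → S => freq (Fin.init x) (x (Fin.last n)) :=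
    measurable_freq.comp ((measurable_pi_apply (Fin.last n)).prodMk
      (measurable_pi_lambda _ fun i => measurable_pi_apply (Fin.castSucc i)))
  have : IsFiniteMeasure (condSample g n c j p) := inferInstanceAs (IsFiniteMeasure (cond _ _))
  exact integral_natCast_eq_sum hmeas fun x => by
    classical exact (Finset.card_filter_le _ _).trans_eq (by simp)

end Sampling

/-! ### The mixing law -/

section Mixing

variable {Ω S : Type*} [MeasurableSpace Ω] [MeasurableSpace S]

theorem measurable_kernel_real_singleton [MeasurableEq S] (κ : Kernel Ω S) [IsFiniteKernel κ] :
    Measurable fun q : Ω × S => (κ q.1).real {q.2} := by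
  have hdiag : MeasurableSet {q : (Ω × S) × S | q.2 = q.1.2} :=
    measurableSet_eq_fun measurable_snd (measurable_snd.comp measurable_fst)
  exact (Kernel.measurable_kernel_prodMk_left (κ := κ.comap Prod.fst measurable_fst)
    hdiag).ennreal_toReal

/-- The kernel that maps `ω` to the law of the mass that `κ ω` gives to a point drawn from it. -/
noncomputable def pointMassKernel (κ : Kernel Ω S) : Kernel Ω ℝ :=
  (Kernel.id ×ₖ κ).map fun q => (κ q.1).real {q.2}

theorem pointMassKernel_apply [MeasurableEq S] (κ : Kernel Ω S) [IsFiniteKernel κ] (ω : Ω) :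
    pointMassKernel κ ω = (κ ω).map fun s => (κ ω).real {s} := by
  have hmass := measurable_kernel_real_singleton κ
  rw [pointMassKernel, Kernel.map_apply _ hmass, Kernel.prod_apply, Kernel.id_apply,
    Measure.dirac_prod, Measure.map_map hmass measurable_prodMk_left]
  rfl

instance (κ : Kernel Ω S) [IsFiniteKernel κ] : IsFiniteKernel (pointMassKernel κ) :=
  inferInstanceAs (IsFiniteKernel (Kernel.map _ _))

theorem integral_pointMassKernel [MeasurableEq S] (κ : Kernel Ω S) [IsFiniteKernel κ]
    {F : ℝ → ℝ} (hF : Continuous F) (ω : Ω) :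
    ∫ v, F v ∂pointMassKernel κ ω = ∫ s, F ((κ ω).real {s}) ∂κ ω := by
  have hmass : Measurable fun s => (κ ω).real {s} :=
    (measurable_kernel_real_singleton κ).comp measurable_prodMk_left
  rw [pointMassKernel_apply, integral_map hmass.aemeasurable hF.aestronglyMeasurable]

theorem ae_mem_Icc_pointMassKernel [MeasurableEq S] (κ : Kernel Ω S) [IsFiniteKernel κ] (ω : Ω)
    [IsZeroOrProbabilityMeasure (κ ω)] : ∀ᵐ v ∂pointMassKernel κ ω, v ∈ Set.Icc (0 : ℝ) 1 := by
  have hmass : Measurable fun s => (κ ω).real {s} :=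
    (measurable_kernel_real_singleton κ).comp measurable_prodMk_left
  rw [pointMassKernel_apply]
  exact (ae_map_iff hmass.aemeasurable measurableSet_Icc).2
    (ae_of_all _ fun s => ⟨measureReal_nonneg, measureReal_le_one⟩)

variable {μ : Measure Ω} {P : Ω → Measure S} {θ : ℝ} {G₀ : Measure S} {J : ℕ} {g : S → Fin J}

/-- The random law `P_j` as a kernel. -/
noncomputable def bucketKernel (hP : Measurable P) (hg : Measurable g) (j : Fin J) :
    Kernel Ω S :=
  ⟨fun ω => bucketLaw g j (P ω), measurable_cond hP (measurableSet_bucket hg j)⟩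

instance (hP : Measurable P) (hg : Measurable g) (j : Fin J) (ω : Ω) :
    IsZeroOrProbabilityMeasure (bucketKernel hP hg j ω) :=
  inferInstanceAs (IsZeroOrProbabilityMeasure (P ω)[|bucket g j])

instance (hP : Measurable P) (hg : Measurable g) (j : Fin J) :
    IsFiniteKernel (bucketKernel hP hg j) :=
  ⟨1, ENNReal.one_lt_top, fun _ => prob_le_one⟩

theorem mixingLaw_eq_comp [MeasurableEq S] (μ : Measure Ω) (hP : Measurable P)
    (hg : Measurable g) (j : Fin J) :
    mixingLaw μ P g j = pointMassKernel (bucketKernel hP hg j) ∘ₘ μ :=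
  congrArg μ.bind (funext fun ω => (pointMassKernel_apply (bucketKernel hP hg j) ω).symm)

theorem isFiniteMeasure_mixingLaw [MeasurableEq S] [IsFiniteMeasure μ] (hP : Measurable P)
    (hg : Measurable g) (j : Fin J) : IsFiniteMeasure (mixingLaw μ P g j) := by
  rw [mixingLaw_eq_comp μ hP hg]
  infer_instance

theorem ae_mem_Icc_mixingLaw [MeasurableEq S] (hP : Measurable P) (hg : Measurable g)
    (j : Fin J) : ∀ᵐ v ∂mixingLaw μ P g j, v ∈ Set.Icc (0 : ℝ) 1 := by
  rw [mixingLaw_eq_comp μ hP hg]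
  exact (Measure.ae_comp_iff measurableSet_Icc).2
    (ae_of_all _ fun ω => ae_mem_Icc_pointMassKernel _ ω)

theorem integrable_of_continuous_of_ae_mem_Icc {ν : Measure ℝ} [IsFiniteMeasure ν]
    (hν : ∀ᵐ x ∂ν, x ∈ Set.Icc (0 : ℝ) 1) {F : ℝ → ℝ} (hF : Continuous F) : Integrable F ν := by
  obtain ⟨C, hC⟩ := isCompact_Icc.exists_bound_of_continuousOn (hF.continuousOn (s := Set.Icc 0 1))
  exact Integrable.of_bound hF.aestronglyMeasurable C (hν.mono hC)

theorem integral_mixingLaw [MeasurableEq S] [IsFiniteMeasure μ] (hP : Measurable P)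
    (hg : Measurable g) (j : Fin J) {F : ℝ → ℝ} (hF : Continuous F) :
    Integrable (fun ω => ∫ s, F ((bucketLaw g j (P ω)).real {s}) ∂bucketLaw g j (P ω)) μ ∧
      ∫ ω, ∫ s, F ((bucketLaw g j (P ω)).real {s}) ∂bucketLaw g j (P ω) ∂μ
        = ∫ v, F v ∂mixingLaw μ P g j := by
  have := isFiniteMeasure_mixingLaw (μ := μ) hP hg j
  have hInt : Integrable F (mixingLaw μ P g j) :=
    integrable_of_continuous_of_ae_mem_Icc (ae_mem_Icc_mixingLaw hP hg j) hF
  have hinner (ω : Ω) : ∫ v, F v ∂pointMassKernel (bucketKernel hP hg j) ω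
      = ∫ s, F ((bucketLaw g j (P ω)).real {s}) ∂bucketLaw g j (P ω) :=
    integral_pointMassKernel _ hF ω
  rw [mixingLaw_eq_comp μ hP hg, Measure.comp_eq_comp_const_apply] at hInt ⊢
  simp only [← hinner]
  exact ⟨by simpa using hInt.integral_comp, by rw [Kernel.integral_comp hInt, Kernel.const_apply]⟩

theorem IsDirichletProcess.mixingLaw_eq [MeasurableSpace.CountablySeparated S]
    [IsProbabilityMeasure μ] [IsFiniteMeasure G₀] [NullSingletonClass G₀]
    (hP : IsDirichletProcess μ P θ G₀) (hθ : 0 < θ) (hg : Measurable g) {j : Fin J}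
    (hG : 0 < G₀.real (bucket g j)) :
    mixingLaw μ P g j = betaMeasure 1 (θ * G₀.real (bucket g j)) := by
  have := measurableEq_of_countablySeparated (S := S)
  have := isFiniteMeasure_mixingLaw (μ := μ) hP.measurable hg j
  have hb : 0 < θ * G₀.real (bucket g j) := mul_pos hθ hG
  have := isProbabilityMeasureBeta one_pos hb
  have habs {v : ℝ} (hv : v ∈ Set.Icc (0 : ℝ) 1) : |v| ≤ 1 := abs_le.2 ⟨by linarith [hv.1], hv.2⟩
  refine ext_of_integral_pow_eq ((ae_mem_Icc_mixingLaw hP.measurable hg j).mono fun _ => habs)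
    ((ae_mem_Icc_betaMeasure _ _).mono fun _ => habs) fun k => ?_
  calc ∫ v, v ^ k ∂mixingLaw μ P g j
    _ = ∫ ω, ∫ s, (bucketLaw g j (P ω)).real {s} ^ k ∂bucketLaw g j (P ω) ∂μ :=
        (integral_mixingLaw hP.measurable hg j (continuous_pow k)).2.symm
    _ = k.factorial / (ascPochhammer ℝ k).eval (θ * G₀.real (bucket g j) + 1) :=
        hP.integral_integral_cond_singleton_pow hθ (measurableSet_bucket hg j) hG k
    _ = ∫ v, v ^ k ∂betaMeasure 1 (θ * G₀.real (bucket g j)) :=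
        (integral_pow_betaMeasure_one hb k).symm

/-! ### Smoothing over the Dirichlet process -/

theorem IsDirichletProcess.integral_freqProb [MeasurableEq S] [IsProbabilityMeasure μ]
    [IsFiniteMeasure G₀] (hP : IsDirichletProcess μ P θ G₀) (hθ : 0 < θ) (hg : Measurable g)
    (hG : ∀ j, 0 < G₀.real (bucket g j)) {n : ℕ} {c : Fin J → ℕ} (hc : ∑ i, c i = n)
    (j : Fin J) (r : ℕ) :
    Integrable (fun ω => freqProb g n c j r (P ω)) μ ∧
      ∫ ω, freqProb g n c j r (P ω) ∂μ
        = ∫ v, ((c j).choose r : ℝ) * v ^ r * (1 - v) ^ (c j - r) ∂mixingLaw μ P g j := by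
  have := hP.isProbabilityMeasure
  have hpos : ∀ᵐ ω ∂μ, ∀ i, P ω (bucket g i) ≠ 0 :=
    ae_all_iff.2 fun i => hP.ae_ne_zero hθ (measurableSet_bucket hg i) (hG i)
  have hbinomial := hpos.mono fun ω hω => freqProb_eq_integral hg hω hc j r
  obtain ⟨hInt, heq⟩ := integral_mixingLaw (μ := μ) hP.measurable hg j
    (F := fun v => ((c j).choose r : ℝ) * v ^ r * (1 - v) ^ (c j - r)) (by fun_prop)
  exact ⟨hInt.congr (hbinomial.mono fun _ h => h.symm), (integral_congr_ae hbinomial).trans heq⟩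

theorem IsDirichletProcess.integral_freqMean [MeasurableEq S] [IsProbabilityMeasure μ]
    [IsFiniteMeasure G₀] (hP : IsDirichletProcess μ P θ G₀) (hθ : 0 < θ) (hg : Measurable g)
    (hG : ∀ j, 0 < G₀.real (bucket g j)) {n : ℕ} {c : Fin J → ℕ} (hc : ∑ i, c i = n)
    (j : Fin J) :
    Integrable (fun ω => freqMean g n c j (P ω)) μ ∧
      ∫ ω, freqMean g n c j (P ω) ∂μ = c j * ∫ v, v ∂mixingLaw μ P g j := by
  have := isFiniteMeasure_mixingLaw (μ := μ) hP.measurable hg j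
  have hprob (r : ℕ) := hP.integral_freqProb hθ hg hG hc j r
  have hcj : c j ≤ n := hc ▸ Finset.single_le_sum (fun _ _ => Nat.zero_le _) (Finset.mem_univ j)
  simp only [freqMean_eq_sum]
  refine ⟨integrable_finsetSum _ fun r _ => (hprob r).1.const_mul _, ?_⟩
  rw [integral_finsetSum _ fun r _ => (hprob r).1.const_mul _]
  simp only [integral_const_mul, (hprob _).2]
  simp only [← integral_const_mul]
  rw [← integral_finsetSum _ fun r _ => integrable_of_continuous_of_ae_mem_Icc
    (ae_mem_Icc_mixingLaw hP.measurable hg j) (by fun_prop)]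
  simp only [sum_mul_binomial hcj]

end Mixing

/-! ### Strongly universal hash functions split the base measure evenly -/

section EvenSplit

theorem prod_diagonal_eq_zero {S : Type*} [MeasurableSpace S] [MeasurableEq S] (ν ρ : Measure S)
    [SFinite ρ] [NullSingletonClass ρ] : (ν.prod ρ) (Set.diagonal S) = 0 := by
  rw [Measure.prod_apply measurableSet_diagonal]
  have hsection (x : S) : Prod.mk x ⁻¹' Set.diagonal S = {x} := by
    ext y
    simp [eq_comm]
  simp [hsection]

-- The squared deviations from the mean `1 / card ι` add up to `∑ i, X i ^ 2 - 1 / card ι`, which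
-- has integral `0`.
theorem ae_forall_eq_inv_card_of_integral_sq {U ι : Type*} [MeasurableSpace U] [Fintype ι]
    {Q : Measure U} [IsProbabilityMeasure Q] {X : ι → U → ℝ}
    (hInt : ∀ i, Integrable (fun u => X i u ^ 2) Q) (hsum : ∀ u, ∑ i, X i u = 1)
    (hsq : ∀ i, ∫ u, X i u ^ 2 ∂Q = ((Fintype.card ι : ℝ) ^ 2)⁻¹) :
    ∀ᵐ u ∂Q, ∀ i, X i u = (Fintype.card ι : ℝ)⁻¹ := by
  cases isEmpty_or_nonempty ι
  · simp
  have hcard : (Fintype.card ι : ℝ) ≠ 0 := by simp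
  have hdev (u : U) : ∑ i, (X i u - (Fintype.card ι : ℝ)⁻¹) ^ 2
      = ∑ i, X i u ^ 2 - (Fintype.card ι : ℝ)⁻¹ := by
    simp only [sub_sq, Finset.sum_add_distrib, Finset.sum_sub_distrib, ← Finset.sum_mul,
      ← Finset.mul_sum, hsum u, Finset.sum_const, Finset.card_univ, nsmul_eq_mul]
    field_simp
    ring
  have hdevint : Integrable (fun u => ∑ i, (X i u - (Fintype.card ι : ℝ)⁻¹) ^ 2) Q := by
    simp only [hdev]
    exact (integrable_finsetSum _ fun i _ => hInt i).sub (integrable_const _)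
  have hzero : ∫ u, ∑ i, (X i u - (Fintype.card ι : ℝ)⁻¹) ^ 2 ∂Q = 0 := by
    simp only [hdev]
    rw [integral_sub (integrable_finsetSum _ fun i _ => hInt i) (integrable_const _),
      integral_finsetSum _ fun i _ => hInt i]
    simp only [hsq, Finset.sum_const, Finset.card_univ, nsmul_eq_mul, integral_const,
      probReal_univ, one_smul]
    field_simp
    simp
  rw [integral_eq_zero_iff_of_nonneg (fun u => Finset.sum_nonneg fun i _ => sq_nonneg _) hdevint]
    at hzero
  filter_upwards [hzero] with u hu i
  have := (Finset.sum_eq_zero_iff_of_nonneg fun i _ => sq_nonneg _).1 hu i (Finset.mem_univ i)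
  exact sub_eq_zero.1 ((pow_eq_zero_iff two_ne_zero).1 this)

theorem sum_measureReal_bucket {S : Type*} [MeasurableSpace S] {J : ℕ} {g : S → Fin J}
    (hg : Measurable g) (p : Measure S) [IsFiniteMeasure p] :
    ∑ j, p.real (bucket g j) = p.real Set.univ := by
  simpa [bucket] using
    sum_measureReal_preimage_singleton (μ := p) Finset.univ fun j _ => measurableSet_bucket hg j

theorem prod_setOf_hash_eq {S : Type*} [MeasurableSpace S] {J : ℕ} (p : Measure S) [SFinite p]
    (g : S → Fin J) (j : Fin J) :
    (p.prod p) {q | g q.1 = j ∧ g q.2 = j} = p (bucket g j) ^ 2 := by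
  rw [sq, ← Measure.prod_prod]
  rfl

variable {S U : Type*} [MeasurableSpace S] [MeasurableEq S] [MeasurableSpace U] {J : ℕ}
  {G₀ : Measure S} [IsProbabilityMeasure G₀] [NullSingletonClass G₀] {Q : Measure U}
  {h : U → S → Fin J}

theorem lintegral_bucket_sq (huniv : IsStronglyUniversal Q h) (hindep : IsIndepOfDraws Q h G₀)
    (j : Fin J) : ∫⁻ u, G₀ (bucket (h u) j) ^ 2 ∂Q = ((J : ℝ≥0∞) ^ 2)⁻¹ := by
  have hdistinct : ∀ᵐ p ∂G₀.prod G₀, p.1 ≠ p.2 :=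
    measure_eq_zero_iff_ae_notMem.1 (prod_diagonal_eq_zero G₀ G₀)
  calc ∫⁻ u, G₀ (bucket (h u) j) ^ 2 ∂Q
    _ = ∫⁻ p, Q {u | h u p.1 = j ∧ h u p.2 = j} ∂G₀.prod G₀ := by
        simpa only [prod_setOf_hash_eq] using (hindep j).2
    _ = ∫⁻ _, ((J : ℝ≥0∞) ^ 2)⁻¹ ∂G₀.prod G₀ :=
        lintegral_congr_ae (hdistinct.mono fun p hp => huniv.pairwise _ _ hp j j)
    _ = ((J : ℝ≥0∞) ^ 2)⁻¹ := by simp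

theorem ae_bucket_eq_inv [IsProbabilityMeasure Q] (hmeas : ∀ u, Measurable (h u))
    (huniv : IsStronglyUniversal Q h) (hindep : IsIndepOfDraws Q h G₀) :
    ∀ᵐ u ∂Q, ∀ j, G₀ (bucket (h u) j) = (J : ℝ≥0∞)⁻¹ := by
  have hmeassq (j : Fin J) : AEMeasurable (fun u => G₀ (bucket (h u) j) ^ 2) Q := by
    simpa only [prod_setOf_hash_eq] using (hindep j).1
  have hlint (j : Fin J) := lintegral_bucket_sq huniv hindep j
  have hreal (j : Fin J) (u : U) :
      G₀.real (bucket (h u) j) ^ 2 = (G₀ (bucket (h u) j) ^ 2).toReal := by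
    rw [measureReal_def, ENNReal.toReal_pow]
  have hInt (j : Fin J) : Integrable (fun u => G₀.real (bucket (h u) j) ^ 2) Q := by
    simp only [hreal]
    refine integrable_toReal_of_lintegral_ne_top (hmeassq j) ?_
    simp [hlint, j.pos.ne']
  have hsq (j : Fin J) :
      ∫ u, G₀.real (bucket (h u) j) ^ 2 ∂Q = ((Fintype.card (Fin J) : ℝ) ^ 2)⁻¹ := by
    simp only [hreal]
    rw [integral_toReal (hmeassq j) (ae_of_all _ fun u => by finiteness), hlint]
    simp
  have hsum (u : U) : ∑ j, G₀.real (bucket (h u) j) = 1 := by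
    rw [sum_measureReal_bucket (hmeas u), probReal_univ]
  filter_upwards [ae_forall_eq_inv_card_of_integral_sq hInt hsum hsq] with u hu j
  rw [← ENNReal.toReal_eq_toReal_iff' (measure_ne_top _ _) (by simp [j.pos.ne'])]
  simpa [measureReal_def] using hu j

end EvenSplit

end SmoothedSketch

open SmoothedSketch in
theorem proposition1_general
    {S U Ω : Type*} [MeasurableSpace S] [MeasurableSpace.CountablySeparated S]
    [MeasurableSpace U] [MeasurableSpace Ω] {J : ℕ} {θ : ℝ} (hθ : 0 < θ)
    {G₀ : Measure S} [IsProbabilityMeasure G₀] [NullSingletonClass G₀]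
    {μ : Measure Ω} [IsProbabilityMeasure μ] {P : Ω → Measure S} (hP : IsDirichletProcess μ P θ G₀)
    {Q : Measure U} [IsProbabilityMeasure Q] {h : U → S → Fin J} (hmeas : ∀ u, Measurable (h u))
    (huniv : IsStronglyUniversal Q h) (hindep : IsIndepOfDraws Q h G₀) :
    (∀ᵐ u ∂Q, ∀ j, G₀ (bucket (h u) j) = (J : ℝ≥0∞)⁻¹) ∧
    ∀ g : S → Fin J, Measurable g → (∀ j, G₀ (bucket g j) ≠ 0) →
      ∀ (j : Fin J) (b : ℝ), b = θ * G₀.real (bucket g j) →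
        mixingLaw μ P g j = betaMeasure 1 b ∧
        ∀ (n : ℕ) (c : Fin J → ℕ), ∑ i, c i = n →
          (∀ r ≤ c j,
            Integrable (fun ω => freqProb g n c j r (P ω)) μ ∧
            ∫ ω, freqProb g n c j r (P ω) ∂μ
              = ∫ v, ((c j).choose r : ℝ) * v ^ r * (1 - v) ^ (c j - r) ∂(mixingLaw μ P g j) ∧
            ∫ ω, freqProb g n c j r (P ω) ∂μ = betaBinomial (c j) 1 b r ∧
            ∫ ω, freqProb g n c j r (P ω) ∂μ
              = ((c j).choose r : ℝ) * b
                * (Real.Gamma (r + 1) * Real.Gamma (b + c j - r) / Real.Gamma (b + c j + 1))) ∧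
          Integrable (fun ω => freqMean g n c j (P ω)) μ ∧
          ∫ ω, freqMean g n c j (P ω) ∂μ = c j * (1 / (b + 1)) := by
  have := measurableEq_of_countablySeparated (S := S)
  refine ⟨ae_bucket_eq_inv hmeas huniv hindep, fun g hg hG j b hbdef => ?_⟩
  have hGpos (i : Fin J) : 0 < G₀.real (bucket g i) :=
    ENNReal.toReal_pos (hG i) (measure_ne_top _ _)
  have hb : 0 < b := hbdef ▸ mul_pos hθ (hGpos j)
  have hlaw : mixingLaw μ P g j = betaMeasure 1 b := hbdef ▸ hP.mixingLaw_eq hθ hg (hGpos j)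
  have hmean : ∫ v, v ∂betaMeasure 1 b = 1 / (b + 1) := by
    simpa using integral_pow_betaMeasure_one hb 1
  refine ⟨hlaw, fun n c hc => ⟨fun r hr => ?_, ?_⟩⟩
  · obtain ⟨hInt, hmix⟩ := hP.integral_freqProb hθ hg hGpos hc j r
    have hbeta : ∫ ω, freqProb g n c j r (P ω) ∂μ = betaBinomial (c j) 1 b r := by
      rw [hmix, hlaw, integral_binomial_betaMeasure one_pos hb hr]
    exact ⟨hInt, hmix, hbeta, hbeta.trans (betaBinomial_one hb _ _)⟩
  · rw [← hmean, ← hlaw]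
    exact hP.integral_freqMean hθ hg hGpos hc j

open SmoothedSketch in
theorem proposition1
    {S U Ω : Type*} [MeasurableSpace S] [MeasurableSpace.CountablySeparated S]
    [MeasurableSpace U] [MeasurableSpace Ω]
    (J : ℕ)
    -- the smoothing distribution `P ∼ DP(θ, G₀)`, with `G₀` non-atomic
    (θ : ℝ) (hθ : 0 < θ) (G₀ : Measure S) [IsProbabilityMeasure G₀] [NullSingletonClass G₀]
    (μ : Measure Ω) [IsProbabilityMeasure μ] (P : Ω → Measure S)
    (hP : IsDirichletProcess μ P θ G₀)
    -- the random hash function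
    (Q : Measure U) [IsProbabilityMeasure Q] (h : U → S → Fin J) (hmeas : ∀ u, Measurable (h u))
    (huniv : IsStronglyUniversal Q h) (hindep : IsIndepOfDraws Q h G₀) :
    -- almost every hash function splits `G₀` evenly among the buckets
    (∀ᵐ u ∂Q, ∀ j, G₀ (bucket (h u) j) = (J : ℝ≥0∞)⁻¹) ∧
    -- and for every hash function that does so, and every bucket:
    ∀ g : S → Fin J, Measurable g → (∀ j, G₀ (bucket g j) = (J : ℝ≥0∞)⁻¹) →
      ∀ j : Fin J,
        -- the mixing variable is `Beta(1, θ/J)`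
        mixingLaw μ P g j = betaMeasure 1 (θ / J) ∧
        -- and for every sketch `c` of a sample of size `n`:
        ∀ (n : ℕ) (c : Fin J → ℕ), ∑ i, c i = n →
          -- `π_j(r) = E[π_j(r; P)]` is the mixed Binomial probability, and is Beta-Binomial
          (∀ r ≤ c j,
            Integrable (fun ω => freqProb g n c j r (P ω)) μ ∧
            ∫ ω, freqProb g n c j r (P ω) ∂μ
              = ∫ v, ((c j).choose r : ℝ) * v ^ r * (1 - v) ^ (c j - r) ∂(mixingLaw μ P g j) ∧
            ∫ ω, freqProb g n c j r (P ω) ∂μ = betaBinomial (c j) 1 (θ / J) r ∧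
            ∫ ω, freqProb g n c j r (P ω) ∂μ
              = ((c j).choose r : ℝ) * (θ / J)
                * (Real.Gamma (r + 1) * Real.Gamma (θ / J + c j - r)
                  / Real.Gamma (θ / J + c j + 1))) ∧
          -- the smoothed frequency estimator `E[ε_f(P)]`
          Integrable (fun ω => freqMean g n c j (P ω)) μ ∧
          ∫ ω, freqMean g n c j (P ω) ∂μ = c j * (J / (θ + J)) := by
  obtain ⟨hsplit, hbucket⟩ := proposition1_general hθ hP hmeas huniv hindep
  refine ⟨hsplit, fun g hg hG j => ?_⟩
  have hJ : (0 : ℝ) < J := Nat.cast_pos.2 j.pos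
  have hmean : 1 / (θ / J + 1) = J / (θ + J) := by field_simp
  rw [← hmean]
  exact hbucket g hg (by simp [hG]) j (θ / J) (by simp [measureReal_def, hG, div_eq_mul_inv])
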